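/- Let $X$ be a (real or complex) Banach space and let $A: D(A)\to X$ be the infinitesimal generator of a $C^0$-semigroup $(\mathrm{e}^{tA})_{t\ge 0}$ of bounded linear operators on $X$. Let $m \in \mathbb{N}_0$ and let $f_i: X\to X$, $i=1,\dots,m$, be continuous vector fields which, regarded as time-independent vector fields $g(t,\xi) := f_i(\xi)$ on $\mathbb{R}_0^+\times X$, satisfy: (A1) for every bounded set $C\subset X$ there exists $L\in L^\infty_{\rm loc}(\mathbb{R}_0^+,\mathbb{R}_0^+)$ such that $\|g(t,\xi)-g(t,\eta)\|\le L(t)\|\xi-\eta\|$ for all $\xi,\eta\in C$ and all $t\ge 0$; (A2) there exist $\alpha,\beta\in L^\infty_{\rm loc}(\mathbb{R}_0^+,\mathbb{R}_0^+)$ such that $\|g(t,\xi)\|\le\alpha(t)\|\xi\|+\beta(t)$ for all $\xi\in X$ and all $t\ge 0$. (For such time-independent fields this just says that every $f_i$ is Lipschitz on bounded sets and linearly bounded.) For $T\ge 0$, $\xi_0\in X$, $1 < p\le\infty$ and $u=(u_1,\dots,u_m)\in L^p([0,T],\mathbb{R}^m)$, a mild solution on $[0,T]$ of $$\dot x(t)=Ax(t)+\sum_{i=1}^m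 u_i(t) f_i(x(t)),\qquad x(0)=\xi_0,$$ is a continuous function $x:[0,T]\to X$ with $$x(t)=\mathrm{e}^{tA}\xi_0+\sum_{i=1}^m\int_0^t \mathrm{e}^{(t-s)A}u_i(s)f_i(x(s))\,\mathrm{d}s\qquad\text{for all }t\in[0,T].$$ Let $\mathcal{R}^p_{\le T}(\xi_0)$ be the set of all states $x(t)$, where $t\in[0,T]$ and $x$ is a mild solution on $[0,T]$ for some control $u\in L^p([0,T],\mathbb{R}^m)$, and let $\mathcal{R}^p(\xi_0):=\bigcup_{T\ge 0}\mathcal{R}^p_{\le T}(\xi_0)$ be the reachable set of $\xi_0$. Then for all $\xi_0\in X$ and all $1 < p\le\infty$ the reachable set $\mathcal{R}^p(\xi_0)$ is a union of countably many relatively compact subsets of $X$ (that is, subsets with compact closure). Moreover, if $X$ is infinite-dimensional, then $\mathcal{R}^p(\xi_0)$ has no interior points. -/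

import Mathlib

open MeasureTheory Filter Topology Set
open scoped ENNReal

/-- `S` is a `C⁰`-semigroup of bounded linear operators on `X`. Only the operators `S t` with `t ≥ 0`
are constrained (and used); the values at negative times are irrelevant. -/
structure IsC0Semigroup {𝕜 X : Type*} [RCLike 𝕜] [NormedAddCommGroup X] [NormedSpace 𝕜 X]
    (S : ℝ → X →L[𝕜] X) : Prop where
  map_zero : S 0 = ContinuousLinearMap.id 𝕜 X
  map_add : ∀ s t : ℝ, 0 ≤ s → 0 ≤ t → S (s + t) = (S s).comp (S t)
  strongly_continuous : ∀ ξ : X, ContinuousOn (fun t : ℝ => S t ξ) (Ici 0)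

/-- The (possibly unbounded) operator `A : D(A) → X` is the infinitesimal generator of `S`:
`ξ ∈ D(A)` and `A ξ = η` if and only if `(S h ξ - ξ) / h → η` as `h ↓ 0`. -/
def IsInfinitesimalGenerator {𝕜 X : Type*} [RCLike 𝕜] [NormedAddCommGroup X] [NormedSpace 𝕜 X]
    [NormedSpace ℝ X] (A : X →ₗ.[𝕜] X) (S : ℝ → X →L[𝕜] X) : Prop :=
  ∀ ξ η : X, (ξ, η) ∈ A.graph ↔
    Tendsto (fun h : ℝ => h⁻¹ • (S h ξ - ξ)) (𝓝[>] 0) (𝓝 η)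

/-- `L ∈ L^∞_loc(ℝ₀⁺, ℝ₀⁺)`. -/
def MemLInftyLocNonneg (L : ℝ → ℝ) : Prop :=
  (∀ t : ℝ, 0 ≤ t → 0 ≤ L t) ∧ ∀ T : ℝ, 0 ≤ T → MemLp L ∞ (volume.restrict (Icc 0 T))

/-- The time-dependent vector field `g : ℝ₀⁺ × X → X` is Lipschitz in the space variable on bounded
sets, with `L^∞_loc`-Lipschitz rate. -/
def LipschitzOnBoundedSets {X : Type*} [NormedAddCommGroup X] (g : ℝ → X → X) : Prop :=
  ∀ C : Set X, Bornology.IsBounded C → ∃ L : ℝ → ℝ, MemLInftyLocNonneg L ∧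
    ∀ ξ ∈ C, ∀ η ∈ C, ∀ t : ℝ, 0 ≤ t → ‖g t ξ - g t η‖ ≤ L t * ‖ξ - η‖

/-- The time-dependent vector field `g : ℝ₀⁺ × X → X` is linearly bounded, with `L^∞_loc`
coefficients. -/
def LinearlyBounded {X : Type*} [NormedAddCommGroup X] (g : ℝ → X → X) : Prop :=
  ∃ α β : ℝ → ℝ, MemLInftyLocNonneg α ∧ MemLInftyLocNonneg β ∧
    ∀ ξ : X, ∀ t : ℝ, 0 ≤ t → ‖g t ξ‖ ≤ α t * ‖ξ‖ + β t

/-- `u ∈ L^p([0,T], ℝ^m)`, written through the `m` components of `u`. -/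
def IsControl {m : ℕ} (p : ℝ≥0∞) (T : ℝ) (u : Fin m → ℝ → ℝ) : Prop :=
  ∀ i, MemLp (u i) p (volume.restrict (Icc 0 T))

/-- `x : [0,T] → X` is a mild solution of `x' = A x + ∑ i, u i (t) • f i (x)`, `x 0 = ξ₀`, where
`S t = e^{tA}`: it is continuous and satisfies, for all `t ∈ [0,T]`,
`x t = e^{tA} ξ₀ + ∑ i, ∫₀ᵗ e^{(t-s)A} u i (s) f i (x s) ds`.
(For integrable controls and continuous `f i`, `x` these Bochner integrals converge.) -/
def IsMildSolution {𝕜 X : Type*} [RCLike 𝕜] [NormedAddCommGroup X] [NormedSpace 𝕜 X]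
    [NormedSpace ℝ X] {m : ℕ} (S : ℝ → X →L[𝕜] X) (f : Fin m → X → X) (ξ₀ : X) (T : ℝ)
    (u : Fin m → ℝ → ℝ) (x : ℝ → X) : Prop :=
  ContinuousOn x (Icc 0 T) ∧
    ∀ t ∈ Icc 0 T, x t = S t ξ₀ + ∑ i, ∫ s in (0 : ℝ)..t, S (t - s) (u i s • f i (x s))

/-- The reachable set up to time `T` under `L^p` controls: all states `x t`, `t ∈ [0,T]`, of mild
solutions `x` on `[0,T]` starting at `ξ₀` and driven by some `u ∈ L^p([0,T], ℝ^m)`. -/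
def reachableSetUpTo {𝕜 X : Type*} [RCLike 𝕜] [NormedAddCommGroup X] [NormedSpace 𝕜 X]
    [NormedSpace ℝ X] {m : ℕ} (S : ℝ → X →L[𝕜] X) (f : Fin m → X → X) (p : ℝ≥0∞) (T : ℝ)
    (ξ₀ : X) : Set X :=
  {y | ∃ t ∈ Icc 0 T, ∃ u : Fin m → ℝ → ℝ, IsControl p T u ∧
    ∃ x : ℝ → X, IsMildSolution S f ξ₀ T u x ∧ x t = y}

/-- The reachable set `R^p(ξ₀)`: the union over all `T ≥ 0` of the reachable sets up to time `T`. -/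
def reachableSet {𝕜 X : Type*} [RCLike 𝕜] [NormedAddCommGroup X] [NormedSpace 𝕜 X]
    [NormedSpace ℝ X] {m : ℕ} (S : ℝ → X →L[𝕜] X) (f : Fin m → X → X) (p : ℝ≥0∞)
    (ξ₀ : X) : Set X :=
  ⋃ T ∈ Ici (0 : ℝ), reachableSetUpTo S f p T ξ₀

/-!
The reachable set is exhausted by the sets `endpoints S f ξ₀ N s` of states reached in time at most
`N` at control cost `∫ ∑ i, |u i| ≤ s`; since `L^p ⊆ L¹` on bounded intervals, every reachable state
has finite cost. It suffices that these sets are totally bounded. No weak compactness of controls is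
needed: a bound in `L¹` is enough.

Two facts carry the argument. By the Hahn-Banach theorem, `∑ i, ∫ u i • d i` lies in `r • C` if the
`d i` take values in a closed absolutely convex set `C` and `∫ ∑ i, |u i| ≤ r`
(`sum_integral_smul_mem`). By Mazur's theorem, the values `S ρ (f i z)`, with `ρ ∈ [0, N]` and `z` in a
compact set, lie in a compact absolutely convex set (`IsC0Semigroup.exists_compact_absConvex`). Hence
if the states of cost at most `s - δ` form a relatively compact set, a state of cost at most `s` is the
sum of an element of a fixed compact set and of the contribution of the last piece of the control,
whose cost is at most `δ` (`IsTrajectory.exists_decomposition`). If `δ` is small compared to the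
Lipschitz constants, a finite `ε`-net of the states of cost at most `s` therefore gives a finite
`ε / 2`-net, so these states form a totally bounded set (`totallyBounded_of_net_halving`). Increasing
the cost in steps of `δ` reaches every `s` (`totallyBounded_endpoints`). Lipschitz constants are
available on bounded sets only, so the same induction is first run for norms, as a substitute for
Gronwall's inequality (`isBounded_endpoints`).

In infinite dimensions, compact sets have empty interior, and a countable union of relatively compact
sets is meagre, so the Baire category theorem gives the second assertion.
-/

/-! ### Integrals of functions with values in an absolutely convex set -/

theorem absConvex_closedBall_zero {X : Type*} [NormedAddCommGroup X] [NormedSpace ℝ X] (ρ : ℝ) :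
    AbsConvex ℝ (Metric.closedBall (0 : X) ρ) :=
  ⟨balanced_closedBall_zero, convex_closedBall _ _⟩

open scoped Pointwise in
/-- If the `d i` take values in a closed absolutely convex set `C` and the scalar weights `u i` have
total mass at most `r`, then `∑ i, ∫ u i • d i` lies in `r • C`: no continuous linear functional can
separate it from `r • C`. -/
theorem sum_integral_smul_mem {X ι : Type*} [NormedAddCommGroup X] [NormedSpace ℝ X]
    [CompleteSpace X] [Fintype ι] {C : Set X} (hC : AbsConvex ℝ C) (hcl : IsClosed C)
    (h0 : (0 : X) ∈ C) {a b r : ℝ} (hab : a ≤ b) (hr : 0 < r) {u : ι → ℝ → ℝ} {d : ι → ℝ → X}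
    (hu : ∀ i, IntervalIntegrable (u i) volume a b)
    (hud : ∀ i, IntervalIntegrable (fun s => u i s • d i s) volume a b)
    (hd : ∀ i, ∀ s ∈ Ioc a b, d i s ∈ C) (hur : ∫ s in a..b, ∑ i, |u i s| ≤ r) :
    ∑ i, ∫ s in a..b, u i s • d i s ∈ r • C := by
  by_contra h
  obtain ⟨l, w, hlw, hwl⟩ := geometric_hahn_banach_closed_point (hC.2.smul r)
    (hcl.smul_of_ne_zero hr.ne') h
  have hw : 0 < w := by simpa using hlw _ ⟨0, h0, rfl⟩
  have habs : ∀ c ∈ C, |l c| ≤ w / r := by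
    intro c hc
    have h1 := hlw _ ⟨c, hc, rfl⟩
    have h2 := hlw _ ⟨-c, hC.1.neg_mem_iff.2 hc, rfl⟩
    simp only [map_smul, smul_eq_mul, map_neg, mul_neg] at h1 h2
    rw [le_div_iff₀' hr]
    calc r * |l c| = |r * l c| := by rw [abs_mul, abs_of_pos hr]
      _ ≤ w := (abs_lt.2 ⟨by linarith, h1⟩).le
  have hint : ∀ i, IntervalIntegrable (fun s => |u i s|) volume a b := fun i => (hu i).abs
  have key : l (∑ i, ∫ s in a..b, u i s • d i s) ≤ w / r * ∫ s in a..b, ∑ i, |u i s| := by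
    rw [map_sum, intervalIntegral.integral_finsetSum (fun i _ => hint i), Finset.mul_sum]
    refine Finset.sum_le_sum fun i _ => ?_
    rw [← l.intervalIntegral_comp_comm (hud i), ← intervalIntegral.integral_const_mul]
    have hli : IntervalIntegrable (fun s => l (u i s • d i s)) volume a b :=
      ⟨l.integrable_comp (hud i).1, l.integrable_comp (hud i).2⟩
    refine intervalIntegral.integral_mono_on_of_le_Ioo hab hli ((hint i).const_mul _) ?_
    intro s hs
    rw [map_smul, smul_eq_mul, mul_comm (w / r)]
    refine (le_abs_self _).trans ?_
    rw [abs_mul]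
    exact mul_le_mul_of_nonneg_left (habs _ (hd i s ⟨hs.1, hs.2.le⟩)) (abs_nonneg _)
  have : w / r * ∫ s in a..b, ∑ i, |u i s| ≤ w / r * r :=
    mul_le_mul_of_nonneg_left hur (by positivity)
  rw [div_mul_cancel₀ _ hr.ne'] at this
  linarith

/-! ### Advancing along the accumulated control cost -/

/-- A path whose cost `V` is at most `s` can be cut at some `τ` so that the final piece costs at most
`δ`, while every point of the initial piece (possibly empty) is reached at cost at most `s - δ`. -/
theorem exists_split_of_le_add {V : ℝ → ℝ} {t s δ : ℝ} (ht : 0 ≤ t)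
    (hV : ContinuousOn V (Icc 0 t)) (hmono : MonotoneOn V (Icc 0 t)) (h0 : V 0 = 0)
    (hδ : 0 < δ) (hs : V t ≤ s) :
    ∃ τ ∈ Icc 0 t, V t - V τ ≤ δ ∧ ∀ σ ∈ Ioc 0 τ, V σ ≤ s - δ := by
  -- When the whole path is cheap, `τ = 0` works, the last condition being vacuous.
  by_cases h : V t ≤ δ
  · exact ⟨0, ⟨le_rfl, ht⟩, by linarith, fun σ hσ => absurd hσ.1 (not_lt.2 hσ.2)⟩
  · obtain ⟨τ, hτ, hVτ⟩ := intermediate_value_Icc ht hV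
      (show V t - δ ∈ Icc (V 0) (V t) from ⟨by linarith [not_le.1 h], by linarith⟩)
    refine ⟨τ, hτ, by linarith, fun σ hσ => ?_⟩
    have := hmono ⟨hσ.1.le, hσ.2.trans hτ.2⟩ hτ hσ.2
    linarith

theorem induction_on_increment {P : ℝ → Prop} {r δ : ℝ} (hδ : 0 < δ)
    (hneg : ∀ s < 0, P s) (hstep : ∀ s ≤ r, P (s - δ) → P s) : P r := by
  have key : ∀ n : ℕ, ∀ s ≤ r, s < n * δ → P s := by
    intro n
    induction n with
    | zero => intro s _ hs; exact hneg s (by simpa using hs)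
    | succ n ih =>
      intro s hsr hs
      refine hstep s hsr (ih _ (by linarith) ?_)
      push_cast at hs
      linarith
  obtain ⟨n, hn⟩ := exists_nat_gt (r / δ)
  exact key n r le_rfl ((div_lt_iff₀ hδ).1 hn)

/-! ### Total boundedness and Baire category -/

/-- A bounded set is totally bounded if each finite `ε`-net `F` of it yields a compact set within
distance `ε / 8` of it. The hypothesis turns a finite `ε`-net into a finite `ε / 2`-net, and the net
may be taken inside the set at the price of a factor `2`. -/
theorem totallyBounded_of_net_halving {X : Type*} [NormedAddCommGroup X] {E : Set X}
    (hE : Bornology.IsBounded E)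
    (h : ∀ ε > 0, ∀ F ⊆ E, F.Finite → (∀ y ∈ E, ∃ z ∈ F, dist y z < ε) →
      ∃ Q : Set X, IsCompact Q ∧ ∀ y ∈ E, ∃ q ∈ Q, dist y q ≤ ε / 8) : TotallyBounded E := by
  rcases E.eq_empty_or_nonempty with rfl | ⟨y₀, hy₀⟩
  · exact totallyBounded_empty
  obtain ⟨R, hR, hER⟩ := hE.subset_ball_lt 0 y₀
  have key : ∀ n : ℕ, ∃ F ⊆ E, F.Finite ∧ ∀ y ∈ E, ∃ z ∈ F, dist y z < R / 2 ^ n := by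
    intro n
    induction n with
    | zero => exact ⟨{y₀}, by simpa using hy₀, finite_singleton _, fun y hy =>
        ⟨y₀, rfl, by simpa using hER hy⟩⟩
    | succ n ih =>
      obtain ⟨F, hFE, hF, hnet⟩ := ih
      have hε : 0 < R / 2 ^ n := by positivity
      obtain ⟨Q, hQ, hEQ⟩ := h _ hε F hFE hF hnet
      have hhalf : R / 2 ^ (n + 1) = R / 2 ^ n / 2 := by rw [pow_succ]; field_simp
      rw [hhalf]
      generalize R / 2 ^ n = ε at *
      obtain ⟨G, -, hG, hQG⟩ := hQ.finite_cover_balls (show 0 < ε / 16 by positivity)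
      -- Keep the centres `g ∈ G` that come close to `E`, and replace each by a nearby point of `E`.
      choose! c hc using fun (g : X) (hg : ∃ y ∈ E, dist y g < ε / 4) => hg
      refine ⟨c '' {g ∈ G | ∃ y ∈ E, dist y g < ε / 4}, ?_, (hG.subset (sep_subset _ _)).image _, ?_⟩
      · rintro _ ⟨g, hg, rfl⟩
        exact (hc g hg.2).1
      · intro y hy
        obtain ⟨q, hq, hyq⟩ := hEQ y hy
        obtain ⟨g, hg, hqg⟩ := mem_iUnion₂.1 (hQG hq)
        have hyg : dist y g < ε / 4 := by
          have := dist_triangle y q g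
          rw [Metric.mem_ball] at hqg
          linarith
        have hg' : ∃ y ∈ E, dist y g < ε / 4 := ⟨y, hy, hyg⟩
        refine ⟨c g, mem_image_of_mem _ ⟨hg, hg'⟩, ?_⟩
        have h1 := (hc g hg').2
        have h2 := dist_triangle_right y (c g) g
        linarith
  refine Metric.totallyBounded_iff.2 fun ε hε => ?_
  obtain ⟨n, hn⟩ := exists_pow_lt_of_lt_one (div_pos hε hR) (show (1 / 2 : ℝ) < 1 by norm_num)
  obtain ⟨F, -, hF, hnet⟩ := key n
  refine ⟨F, hF, fun y hy => ?_⟩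
  obtain ⟨z, hz, hyz⟩ := hnet y hy
  refine mem_iUnion₂.2 ⟨z, hz, hyz.trans ?_⟩
  rw [lt_div_iff₀ hR] at hn
  calc R / 2 ^ n = (1 / 2) ^ n * R := by rw [one_div, inv_pow]; field_simp
    _ < ε := hn

theorem interior_iUnion_eq_empty_of_isCompact_closure (𝕜 : Type*) {X : Type*}
    [NontriviallyNormedField 𝕜] [CompleteSpace 𝕜] [NormedAddCommGroup X] [NormedSpace 𝕜 X]
    [CompleteSpace X] (hX : ¬ FiniteDimensional 𝕜 X) {K : ℕ → Set X}
    (hK : ∀ n, IsCompact (closure (K n))) : interior (⋃ n, K n) = ∅ := by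
  have hmeagre : IsMeagre (⋃ n, K n) := by
    refine isMeagre_iUnion fun n => IsNowhereDense.isMeagre ?_
    by_contra hne
    obtain ⟨x, hx⟩ := nonempty_iff_ne_empty.2 hne
    obtain ⟨ε, hε, hball⟩ := Metric.nhds_basis_closedBall.mem_iff.1 (mem_interior_iff_mem_nhds.1 hx)
    exact hX (FiniteDimensional.of_isCompact_closedBall 𝕜 hε
      ((hK n).of_isClosed_subset Metric.isClosed_closedBall hball))
  exact interior_eq_empty_iff_dense_compl.2 (dense_of_mem_residual hmeagre)

/-! ### Orbits of compact sets under a semigroup -/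

section Semigroup

variable {𝕜 X : Type*} [RCLike 𝕜] [NormedAddCommGroup X] [NormedSpace 𝕜 X] [CompleteSpace X]
  {S : ℝ → X →L[𝕜] X}

/-- Uniform boundedness principle: a `C⁰`-semigroup is norm bounded on compact time intervals. -/
theorem IsC0Semigroup.exists_norm_le (hS : IsC0Semigroup S) (N : ℝ) :
    ∃ M, 0 < M ∧ ∀ r ∈ Icc 0 N, ‖S r‖ ≤ M := by
  obtain ⟨M, hM⟩ := banach_steinhaus (g := fun r : Icc (0 : ℝ) N => S r) fun ξ => by
    obtain ⟨c, hc⟩ := isCompact_Icc.exists_bound_of_continuousOn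
      ((hS.strongly_continuous ξ).mono (Icc_subset_Ici_self : Icc 0 N ⊆ Ici 0))
    exact ⟨c, fun r => hc r r.2⟩
  exact ⟨max M 1, by positivity, fun r hr => (hM ⟨r, hr⟩).trans (le_max_left _ _)⟩

theorem IsC0Semigroup.continuousOn_uncurry (hS : IsC0Semigroup S) (N : ℝ) :
    ContinuousOn (fun q : ℝ × X => S q.1 q.2) (Icc 0 N ×ˢ univ) := by
  obtain ⟨M, hM, hSM⟩ := hS.exists_norm_le N
  refine continuousOn_prod_of_continuousOn_lipschitzOnWith' (fun q : ℝ × X => S q.1 q.2)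
    M.toNNReal ?_ ?_
  · intro r hr
    refine (LipschitzWith.of_dist_le_mul fun y z => ?_).lipschitzOnWith
    rw [Real.coe_toNNReal _ hM.le, dist_eq_norm, dist_eq_norm, ← map_sub]
    exact (S r).le_of_opNorm_le (hSM r hr) _
  · exact fun y _ => (hS.strongly_continuous y).mono Icc_subset_Ici_self

/-- The states that the semigroup reaches from the compact sets `f i '' K` within time `N` lie in a
compact absolutely convex set (Mazur's theorem). -/
theorem IsC0Semigroup.exists_compact_absConvex [NormedSpace ℝ X] (hS : IsC0Semigroup S)
    {ι : Type*} [Finite ι] {f : ι → X → X} (hf : ∀ i, Continuous (f i)) (N : ℝ) {K : Set X}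
    (hK : IsCompact K) : ∃ C : Set X, IsCompact C ∧ AbsConvex ℝ C ∧ 0 ∈ C ∧
      ∀ ρ ∈ Icc 0 N, ∀ i, ∀ z ∈ K, S ρ (f i z) ∈ C := by
  have hP : IsCompact (⋃ i, (fun q : ℝ × X => S q.1 (f i q.2)) '' (Icc 0 N ×ˢ K)) := by
    refine isCompact_iUnion fun i => (isCompact_Icc.prod hK).image_of_continuousOn ?_
    exact (hS.continuousOn_uncurry N).comp (f := fun q : ℝ × X => (q.1, f i q.2))
      (by have := hf i; fun_prop) (fun q hq => ⟨hq.1, mem_univ _⟩)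
  refine ⟨closedAbsConvexHull ℝ (insert 0 _),
    isCompact_closedAbsConvexHull_of_totallyBounded (hP.insert 0).totallyBounded,
    absConvex_convexClosedHull, subset_closedAbsConvexHull (mem_insert _ _), ?_⟩
  intro ρ hρ i z hz
  exact subset_closedAbsConvexHull (mem_insert_of_mem _
    (mem_iUnion.2 ⟨i, ⟨(ρ, z), ⟨hρ, hz⟩, rfl⟩⟩))

end Semigroup

/-! ### Trajectories of bounded control cost -/

section Trajectories

variable {𝕜 X : Type*} [RCLike 𝕜] [NormedAddCommGroup X] [NormedSpace 𝕜 X] [NormedSpace ℝ X]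
  {m : ℕ} {S : ℝ → X →L[𝕜] X} {f : Fin m → X → X} {ξ₀ : X}

/-- `x` is a mild solution on `[0, T]` from `ξ₀` for the integrable control `u`, and the cost
`∫₀ᵀ ∑ i, |u i|` is at most `s`. Only integrability of the control is required, whatever the exponent
`p` of the reachable set is. -/
structure IsTrajectory (S : ℝ → X →L[𝕜] X) (f : Fin m → X → X) (ξ₀ : X) (s T : ℝ)
    (u : Fin m → ℝ → ℝ) (x : ℝ → X) : Prop where
  nonneg : 0 ≤ T
  integrable : ∀ i, IntervalIntegrable (u i) volume 0 T
  mild : IsMildSolution S f ξ₀ T u x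
  cost_le : ∫ σ in (0 : ℝ)..T, ∑ i, |u i σ| ≤ s

/-- The final states `x T` of all trajectories of duration `T ≤ N` and cost at most `s`. Intermediate
states are included as well, since restrictions of trajectories are trajectories. -/
def endpoints (S : ℝ → X →L[𝕜] X) (f : Fin m → X → X) (ξ₀ : X) (N s : ℝ) : Set X :=
  {y | ∃ T ≤ N, ∃ u x, IsTrajectory S f ξ₀ s T u x ∧ x T = y}

theorem IsTrajectory.restrict {s s' t T : ℝ} {u : Fin m → ℝ → ℝ} {x : ℝ → X}
    (h : IsTrajectory S f ξ₀ s T u x) (ht : t ∈ Icc 0 T)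
    (hs' : ∫ σ in (0 : ℝ)..t, ∑ i, |u i σ| ≤ s') : IsTrajectory S f ξ₀ s' t u x where
  nonneg := ht.1
  integrable i := (h.integrable i).mono_set
    (by rw [uIcc_of_le ht.1, uIcc_of_le h.nonneg]; exact Icc_subset_Icc_right ht.2)
  mild := ⟨h.mild.1.mono (Icc_subset_Icc_right ht.2), fun σ hσ => h.mild.2 σ ⟨hσ.1, hσ.2.trans ht.2⟩⟩
  cost_le := hs'

theorem IsTrajectory.intervalIntegrable_cost {s T : ℝ} {u : Fin m → ℝ → ℝ} {x : ℝ → X}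
    (h : IsTrajectory S f ξ₀ s T u x) {a b : ℝ} (ha : a ∈ Icc 0 T) (hb : b ∈ Icc 0 T) :
    IntervalIntegrable (fun σ => ∑ i, |u i σ|) volume a b := by
  have : IntervalIntegrable (∑ i, fun σ => |u i σ|) volume 0 T :=
    IntervalIntegrable.sum _ fun i _ => (h.integrable i).abs
  refine IntervalIntegrable.mono_set ?_ (uIcc_subset_uIcc (a₂ := 0) (b₂ := T) ?_ ?_)
  · convert this using 1
    ext σ
    simp
  · rwa [uIcc_of_le h.nonneg]
  · rwa [uIcc_of_le h.nonneg]

theorem IsTrajectory.monotoneOn_cost {s T : ℝ} {u : Fin m → ℝ → ℝ} {x : ℝ → X}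
    (h : IsTrajectory S f ξ₀ s T u x) :
    MonotoneOn (fun t => ∫ σ in (0 : ℝ)..t, ∑ i, |u i σ|) (Icc 0 T) := by
  intro a ha b hb hab
  have h0 : (0 : ℝ) ∈ Icc 0 T := ⟨le_rfl, h.nonneg⟩
  have hadd := intervalIntegral.integral_add_adjacent_intervals
    (h.intervalIntegrable_cost h0 ha) (h.intervalIntegrable_cost ha hb)
  have hpos : 0 ≤ ∫ σ in a..b, ∑ i, |u i σ| :=
    intervalIntegral.integral_nonneg hab fun σ _ => Finset.sum_nonneg fun i _ => abs_nonneg _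
  dsimp only
  linarith

theorem IsTrajectory.restrict_of_mem {s t T : ℝ} {u : Fin m → ℝ → ℝ} {x : ℝ → X}
    (h : IsTrajectory S f ξ₀ s T u x) (ht : t ∈ Icc 0 T) : IsTrajectory S f ξ₀ s t u x :=
  h.restrict ht ((h.monotoneOn_cost ht ⟨h.nonneg, le_rfl⟩ ht.2).trans h.cost_le)

theorem endpoints_eq_empty_of_neg {N s : ℝ} (hs : s < 0) : endpoints S f ξ₀ N s = ∅ := by
  refine eq_empty_of_forall_notMem ?_
  rintro y ⟨T, -, u, x, h, -⟩
  have : 0 ≤ ∫ σ in (0 : ℝ)..T, ∑ i, |u i σ| :=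
    intervalIntegral.integral_nonneg h.nonneg fun σ _ => Finset.sum_nonneg fun i _ => abs_nonneg _
  linarith [h.cost_le]

variable [CompleteSpace X]

/-- Variation of constants along a trajectory cut so that its final piece costs at most `δ`. The
states on the initial piece are endpoints of cost at most `s - δ`, so their contribution is controlled
by `C₁` with factor `r`; the final piece contributes an element of `C₂` with the small factor `δ`. -/
theorem IsTrajectory.exists_decomposition (hS : IsC0Semigroup S) (hf : ∀ i, Continuous (f i))
    {N s r δ T : ℝ} {u : Fin m → ℝ → ℝ} {x : ℝ → X} (h : IsTrajectory S f ξ₀ s T u x)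
    (hTN : T ≤ N) (hsr : s ≤ r) (hr : 0 < r) (hδ : 0 < δ) {C₁ C₂ : Set X}
    (hC₁ : AbsConvex ℝ C₁) (hC₁' : IsClosed C₁) (h0₁ : 0 ∈ C₁)
    (hC₂ : AbsConvex ℝ C₂) (hC₂' : IsClosed C₂) (h0₂ : 0 ∈ C₂)
    (h₁ : ∀ ρ ∈ Icc 0 N, ∀ i, ∀ z ∈ endpoints S f ξ₀ N (s - δ), S ρ (f i z) ∈ C₁)
    (h₂ : ∀ ρ ∈ Icc 0 N, ∀ i, ∀ σ ∈ Icc 0 T, S ρ (f i (x σ)) ∈ C₂) :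
    ∃ c₁ ∈ C₁, ∃ c₂ ∈ C₂, x T = S T ξ₀ + (r • c₁ + δ • c₂) := by
  have h0 : (0 : ℝ) ∈ Icc 0 T := ⟨le_rfl, h.nonneg⟩
  have hT : T ∈ Icc 0 T := ⟨h.nonneg, le_rfl⟩
  have hVcont : ContinuousOn (fun t => ∫ σ in (0 : ℝ)..t, ∑ i, |u i σ|) (Icc 0 T) := by
    have := intervalIntegral.continuousOn_primitive_interval'
      (h.intervalIntegrable_cost h0 hT) left_mem_uIcc
    rwa [uIcc_of_le h.nonneg] at this
  obtain ⟨τ, hτ, hτδ, hτs⟩ := exists_split_of_le_add h.nonneg hVcont h.monotoneOn_cost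
    (by simp) hδ h.cost_le
  have hsub : ∀ {a b : ℝ}, a ∈ Icc 0 T → b ∈ Icc 0 T → uIcc a b ⊆ uIcc 0 T := fun ha hb =>
    uIcc_subset_uIcc (by rwa [uIcc_of_le h.nonneg]) (by rwa [uIcc_of_le h.nonneg])
  have hd : ∀ i, ContinuousOn (fun σ => S (T - σ) (f i (x σ))) (uIcc 0 T) := by
    intro i
    rw [uIcc_of_le h.nonneg]
    refine (hS.continuousOn_uncurry N).comp (f := fun σ : ℝ => (T - σ, f i (x σ))) ?_ ?_
    · exact (by fun_prop : Continuous fun σ : ℝ => T - σ).continuousOn.prodMk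
        ((hf i).comp_continuousOn h.mild.1)
    · exact fun σ hσ => ⟨⟨by linarith [hσ.2], by linarith [hσ.1]⟩, mem_univ _⟩
  have hud : ∀ i, IntervalIntegrable (fun σ => u i σ • S (T - σ) (f i (x σ))) volume 0 T :=
    fun i => (h.integrable i).smul_continuousOn (hd i)
  have hx : x T = S T ξ₀ + (∑ i, (∫ σ in (0 : ℝ)..τ, u i σ • S (T - σ) (f i (x σ))) +
      ∑ i, ∫ σ in τ..T, u i σ • S (T - σ) (f i (x σ))) := by
    rw [h.mild.2 T hT, ← Finset.sum_add_distrib]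
    congr 1
    refine Finset.sum_congr rfl fun i _ => ?_
    rw [intervalIntegral.integral_add_adjacent_intervals ((hud i).mono_set (hsub h0 hτ))
      ((hud i).mono_set (hsub hτ hT))]
    exact intervalIntegral.integral_congr fun σ _ =>
      map_real_smul (S (T - σ)) (S (T - σ)).continuous (u i σ) (f i (x σ))
  have hcost := intervalIntegral.integral_add_adjacent_intervals
    (h.intervalIntegrable_cost h0 hτ) (h.intervalIntegrable_cost hτ hT)
  obtain ⟨c₁, hc₁, hc₁'⟩ := sum_integral_smul_mem hC₁ hC₁' h0₁ hτ.1 hr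
    (fun i => (h.integrable i).mono_set (hsub h0 hτ)) (fun i => (hud i).mono_set (hsub h0 hτ))
    (fun i σ hσ => h₁ _ ⟨by linarith [hσ.2, hτ.2], by linarith [hσ.1]⟩ i _
      ⟨σ, hσ.2.trans (hτ.2.trans hTN), u, x,
        h.restrict ⟨hσ.1.le, hσ.2.trans hτ.2⟩ (hτs σ hσ), rfl⟩)
    ((h.restrict_of_mem hτ).cost_le.trans hsr)
  obtain ⟨c₂, hc₂, hc₂'⟩ := sum_integral_smul_mem hC₂ hC₂' h0₂ hτ.2 hδ
    (fun i => (h.integrable i).mono_set (hsub hτ hT)) (fun i => (hud i).mono_set (hsub hτ hT))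
    (fun i σ hσ => h₂ _ ⟨by linarith [hσ.2], by linarith [hσ.1, hτ.1]⟩ i _
      ⟨hτ.1.trans hσ.1.le, hσ.2⟩) (by linarith)
  exact ⟨c₁, hc₁, c₂, hc₂, by rw [hx, ← hc₁', ← hc₂']⟩

/-- A priori bound: once the endpoints of cost at most `s - δ` are bounded, the maximum of `‖x‖` along
a trajectory of cost at most `s` is at most a constant plus half of itself, for small `δ`. -/
theorem isBounded_endpoints (hS : IsC0Semigroup S) (hf : ∀ i, Continuous (f i)) {α β : ℝ}
    (hα : 0 ≤ α) (hβ : 0 ≤ β) (hbdd : ∀ i ξ, ‖f i ξ‖ ≤ α * ‖ξ‖ + β) (N r : ℝ) (hr : 0 < r) :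
    Bornology.IsBounded (endpoints S f ξ₀ N r) := by
  obtain ⟨M, hM, hSM⟩ := hS.exists_norm_le N
  obtain ⟨δ, hδ, hδM⟩ : ∃ δ > 0, δ * (M * α) ≤ 1 / 2 := by
    refine ⟨1 / (2 * (M * α + 1)), by positivity, ?_⟩
    rw [div_mul_eq_mul_div, div_le_div_iff₀ (by positivity) (by positivity)]
    nlinarith [mul_nonneg hM.le hα]
  refine induction_on_increment (P := fun s => Bornology.IsBounded (endpoints S f ξ₀ N s)) hδ
    (fun s hs => by rw [endpoints_eq_empty_of_neg hs]; exact Bornology.isBounded_empty) ?_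
  intro s hsr hprev
  obtain ⟨B, hB, hprevB⟩ := hprev.exists_pos_norm_le
  refine isBounded_iff_forall_norm_le.2
    ⟨2 * (M * ‖ξ₀‖ + r * (M * (α * B + β)) + δ * (M * β)), ?_⟩
  rintro _ ⟨T, hTN, u, x, h, rfl⟩
  have hT : T ∈ Icc 0 T := ⟨h.nonneg, le_rfl⟩
  -- The decomposition is applied at a time `t` where the norm along the trajectory is maximal.
  obtain ⟨t, ht, hmax⟩ := isCompact_Icc.exists_isMaxOn ⟨T, hT⟩ h.mild.1.norm
  refine (hmax hT).trans ?_
  change ‖x t‖ ≤ _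
  have hball : ∀ {ρ R : ℝ} {i : Fin m} {z : X}, ρ ∈ Icc 0 N → ‖z‖ ≤ R →
      S ρ (f i z) ∈ Metric.closedBall 0 (M * (α * R + β)) := by
    intro ρ R i z hρ hz
    rw [mem_closedBall_zero_iff]
    refine ((S ρ).le_of_opNorm_le (hSM ρ hρ) _).trans ?_
    gcongr
    exact (hbdd i z).trans (by gcongr)
  obtain ⟨c₁, hc₁, c₂, hc₂, hx⟩ := (h.restrict_of_mem ht).exists_decomposition hS hf
    (ht.2.trans hTN) hsr hr hδ (absConvex_closedBall_zero (M * (α * B + β)))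
    Metric.isClosed_closedBall (Metric.mem_closedBall_self (by positivity))
    (absConvex_closedBall_zero (M * (α * ‖x t‖ + β)))
    Metric.isClosed_closedBall (Metric.mem_closedBall_self (by positivity))
    (fun ρ hρ i z hz => hball hρ (hprevB z hz))
    (fun ρ hρ i σ hσ => hball hρ (hmax ⟨hσ.1, hσ.2.trans ht.2⟩))
  rw [mem_closedBall_zero_iff] at hc₁ hc₂
  have hle : ‖x t‖ ≤ M * ‖ξ₀‖ + (r * (M * (α * B + β)) + δ * (M * (α * ‖x t‖ + β))) := by
    conv_lhs => rw [hx]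
    refine (norm_add_le _ _).trans (add_le_add
      ((S t).le_of_opNorm_le (hSM t ⟨ht.1, ht.2.trans hTN⟩) _) ((norm_add_le _ _).trans ?_))
    rw [norm_smul, norm_smul, Real.norm_of_nonneg hr.le, Real.norm_of_nonneg hδ.le]
    gcongr
  have : δ * (M * α) * ‖x t‖ ≤ 1 / 2 * ‖x t‖ := by gcongr
  linarith

open scoped Pointwise in
/-- For small `δ`, total boundedness passes from the endpoints of cost at most `s - δ` to those of cost
at most `s`: an `ε`-net of the latter confines the contribution of the final piece to a
`δ M L ε`-neighbourhood of a compact set, where `δ M L ≤ 1 / 8`, and the other contributions lie in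
compact sets. -/
theorem totallyBounded_endpoints (hS : IsC0Semigroup S) (hf : ∀ i, Continuous (f i)) {α β : ℝ}
    (hα : 0 ≤ α) (hβ : 0 ≤ β) (hbdd : ∀ i ξ, ‖f i ξ‖ ≤ α * ‖ξ‖ + β)
    (hlip : ∀ R : ℝ, ∃ L, 0 ≤ L ∧ ∀ i, ∀ ξ ∈ Metric.closedBall (0 : X) R,
      ∀ η ∈ Metric.closedBall (0 : X) R, ‖f i ξ - f i η‖ ≤ L * ‖ξ - η‖) (N r : ℝ) (hr : 0 < r) :
    TotallyBounded (endpoints S f ξ₀ N r) := by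
  obtain ⟨M, hM, hSM⟩ := hS.exists_norm_le N
  have hbounded := isBounded_endpoints (ξ₀ := ξ₀) hS hf hα hβ hbdd N r hr
  obtain ⟨R, hR⟩ := hbounded.subset_closedBall 0
  obtain ⟨L, hL, hfL⟩ := hlip R
  obtain ⟨δ, hδ, hδM⟩ : ∃ δ > 0, δ * (M * L) ≤ 1 / 8 := by
    refine ⟨1 / (8 * (M * L + 1)), by positivity, ?_⟩
    rw [div_mul_eq_mul_div, div_le_div_iff₀ (by positivity) (by positivity)]
    nlinarith [mul_nonneg hM.le hL]
  refine induction_on_increment (P := fun s => TotallyBounded (endpoints S f ξ₀ N s)) hδ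
    (fun s hs => by rw [endpoints_eq_empty_of_neg hs]; exact totallyBounded_empty) ?_
  intro s hsr hprev
  have hsub : endpoints S f ξ₀ N s ⊆ endpoints S f ξ₀ N r := by
    rintro _ ⟨T, hT, u, x, h, rfl⟩
    exact ⟨T, hT, u, x, { h with cost_le := h.cost_le.trans hsr }, rfl⟩
  obtain ⟨C₁, hC₁, hC₁a, hC₁0, hC₁S⟩ := hS.exists_compact_absConvex hf N
    (hprev.closure.isCompact_of_isClosed isClosed_closure)
  refine totallyBounded_of_net_halving (hbounded.subset hsub) fun ε hε F hFE hF hnet => ?_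
  obtain ⟨C₂, hC₂, hC₂a, hC₂0, hC₂S⟩ := hS.exists_compact_absConvex hf N hF.isCompact
  have hSξ : IsCompact ((fun t => S t ξ₀) '' Icc 0 N) := isCompact_Icc.image_of_continuousOn
    ((hS.strongly_continuous ξ₀).mono Icc_subset_Ici_self)
  refine ⟨_, hSξ.add ((hC₁.smul r).add (hC₂.smul δ)), ?_⟩
  rintro _ ⟨T, hTN, u, x, h, rfl⟩
  have hρ : 0 ≤ M * (L * ε) := by positivity
  obtain ⟨c₁, hc₁, _, ⟨c₂, hc₂, e, he, rfl⟩, hx⟩ := h.exists_decomposition hS hf hTN hsr hr hδ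
    hC₁a hC₁.isClosed hC₁0
    -- `S ρ (f i (x σ))` is within `M L ε` of `S ρ (f i z)` for a net point `z` near `x σ`.
    (C₂ := C₂ + Metric.closedBall 0 (M * (L * ε)))
    ⟨hC₂a.1.add (absConvex_closedBall_zero _).1, hC₂a.2.add (absConvex_closedBall_zero _).2⟩
    (Metric.isClosed_closedBall.add_left_of_isCompact hC₂)
    ⟨0, hC₂0, 0, Metric.mem_closedBall_self hρ, add_zero 0⟩
    (fun ρ hρ i z hz => hC₁S ρ hρ i z (subset_closure hz))
    (fun ρ hρ i σ hσ => by
      have hxσ : x σ ∈ endpoints S f ξ₀ N s :=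
        ⟨σ, hσ.2.trans hTN, u, x, h.restrict_of_mem hσ, rfl⟩
      obtain ⟨z, hz, hxz⟩ := hnet _ hxσ
      refine ⟨S ρ (f i z), hC₂S ρ hρ i z hz, S ρ (f i (x σ)) - S ρ (f i z), ?_, add_sub_cancel _ _⟩
      rw [mem_closedBall_zero_iff, ← map_sub]
      refine ((S ρ).le_of_opNorm_le (hSM ρ hρ) _).trans ?_
      gcongr
      refine (hfL i _ (hR (hsub hxσ)) _ (hR (hsub (hFE hz)))).trans ?_
      rw [← dist_eq_norm]
      gcongr)
  refine ⟨S T ξ₀ + (r • c₁ + δ • c₂), add_mem_add ⟨T, ⟨h.nonneg, hTN⟩, rfl⟩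
    (add_mem_add (smul_mem_smul_set hc₁) (smul_mem_smul_set hc₂)), ?_⟩
  have hdiff : x T - (S T ξ₀ + (r • c₁ + δ • c₂)) = δ • e := by
    rw [hx]; simp only [smul_add]; abel
  rw [mem_closedBall_zero_iff] at he
  rw [dist_eq_norm, hdiff, norm_smul, Real.norm_of_nonneg hδ.le]
  calc δ * ‖e‖ ≤ δ * (M * (L * ε)) := by gcongr
    _ = δ * (M * L) * ε := by ring
    _ ≤ 1 / 8 * ε := by gcongr
    _ = ε / 8 := by ring

end Trajectories

/-! ### The reachable set -/

theorem corollary3p2 {𝕜 X : Type*} [RCLike 𝕜] [NormedAddCommGroup X] [NormedSpace 𝕜 X]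
    [NormedSpace ℝ X] [CompleteSpace X]
    (A : X →ₗ.[𝕜] X) (S : ℝ → X →L[𝕜] X)
    (hS : IsC0Semigroup S) (hA : IsInfinitesimalGenerator A S)
    {m : ℕ} (f : Fin m → X → X) (hf : ∀ i, Continuous (f i))
    (hLip : ∀ i, LipschitzOnBoundedSets (fun (_ : ℝ) ξ => f i ξ))
    (hBdd : ∀ i, LinearlyBounded (fun (_ : ℝ) ξ => f i ξ))
    (ξ₀ : X) (p : ℝ≥0∞) (hp : 1 < p) :
    (∃ K : ℕ → Set X, (∀ n, IsCompact (closure (K n))) ∧ reachableSet S f p ξ₀ = ⋃ n, K n) ∧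
      (¬ FiniteDimensional 𝕜 X → interior (reachableSet S f p ξ₀) = ∅) := by
  have hlip : ∀ R : ℝ, ∃ L, 0 ≤ L ∧ ∀ i, ∀ ξ ∈ Metric.closedBall (0 : X) R,
      ∀ η ∈ Metric.closedBall (0 : X) R, ‖f i ξ - f i η‖ ≤ L * ‖ξ - η‖ := by
    intro R
    -- The fields do not depend on time, so the coefficients at time `0` are constants that serve
    -- at all times.
    choose L hL hfL using fun i => hLip i (Metric.closedBall 0 R) Metric.isBounded_closedBall
    have h0 : ∀ i, 0 ≤ L i 0 := fun i => (hL i).1 0 le_rfl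
    refine ⟨∑ i, L i 0, Finset.sum_nonneg fun i _ => h0 i, fun i ξ hξ η hη => ?_⟩
    refine (hfL i ξ hξ η hη 0 le_rfl).trans ?_
    gcongr
    exact Finset.single_le_sum (fun j _ => h0 j) (Finset.mem_univ i)
  choose α β hα hβ hfb using hBdd
  have hα0 : ∀ i, 0 ≤ α i 0 := fun i => (hα i).1 0 le_rfl
  have hβ0 : ∀ i, 0 ≤ β i 0 := fun i => (hβ i).1 0 le_rfl
  have hbdd : ∀ i ξ, ‖f i ξ‖ ≤ (∑ i, α i 0) * ‖ξ‖ + ∑ i, β i 0 := by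
    intro i ξ
    refine (hfb i ξ 0 le_rfl).trans ?_
    gcongr
    · exact Finset.single_le_sum (fun j _ => hα0 j) (Finset.mem_univ i)
    · exact Finset.single_le_sum (fun j _ => hβ0 j) (Finset.mem_univ i)
  have hK : ∃ K : ℕ → Set X, (∀ n, IsCompact (closure (K n))) ∧
      reachableSet S f p ξ₀ = ⋃ n, K n := by
    refine ⟨fun n => reachableSet S f p ξ₀ ∩ endpoints S f ξ₀ n (n + 1), fun n => ?_, ?_⟩
    · have htb := totallyBounded_endpoints (ξ₀ := ξ₀) hS hf (Finset.sum_nonneg fun i _ => hα0 i)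
        (Finset.sum_nonneg fun i _ => hβ0 i) hbdd hlip n (n + 1) (by positivity)
      exact (htb.subset inter_subset_right).closure.isCompact_of_isClosed isClosed_closure
    · rw [← inter_iUnion, eq_comm, inter_eq_left]
      intro y hy
      obtain ⟨T, hT, t, ht, u, hu, x, hx, rfl⟩ := mem_iUnion₂.1 hy
      have htraj : IsTrajectory S f ξ₀ _ T u x := ⟨hT, fun i =>
        (intervalIntegrable_iff_integrableOn_Icc_of_le hT).2 ((hu i).integrable hp.le), hx, le_rfl⟩
      obtain ⟨n, hn⟩ := exists_nat_ge (max t (∫ σ in (0 : ℝ)..t, ∑ i, |u i σ|))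
      exact mem_iUnion.2 ⟨n, t, (le_max_left _ _).trans hn, u, x,
        htraj.restrict ht (((le_max_right _ _).trans hn).trans (by linarith)), rfl⟩
  refine ⟨hK, fun hX => ?_⟩
  obtain ⟨K, hKc, hKU⟩ := hK
  rw [hKU]
  exact interior_iUnion_eq_empty_of_isCompact_closure 𝕜 hX hKc
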